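/- Let $g,n\ge 1$ be integers and write $[g]=\{1,\dots,g\}$. The hypercube GPT is the triple $(V,V^+,\mathbb 1)$ with $V=\mathbb R^{n+1}$, $V^+=\{(x_0,x_1,\dots,x_n): x_0\ge \max_{1\le i\le n}|x_i|\}$ and $\mathbb 1(x_0,\dots,x_n)=x_0$; its state space $\{v\in V^+:\mathbb 1(v)=1\}$ is the unit ball of $\ell_\infty^n$. Let $A=V^*$ and let $A^+\subseteq A$ be the dual cone of $V^+$. A dichotomic measurement is a pair $f=(f_1,f_2)$ of elements of $A^+$ with $f_1+f_2=\mathbb 1$. Dichotomic measurements $f^{(1)},\dots,f^{(g)}$ are compatible if there are elements $h_m\in A^+$, $m\in\{1,2\}^g$, with $\sum_m h_m=\mathbb 1$ and $f^{(i)}_j=\sum_{m:\,m_i=j}h_m$ for all $i\in[g]$, $j\in\{1,2\}$. The compatibility region $\Gamma(g;\ell_\infty^n)$ is the set of all $s\in[0,1]^g$ such that, for every collection of $g$ dichotomic measurements $f^{(1)},\dots,f^{(g)}$, the noisy measurements $\big(s_if^{(i)}_j+(1-s_i)\tfrac12\mathbb 1\big)_{j=1,2}$, $i\in[g]$, are compatible;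 the compatibility degree is $\gamma(g;\ell_\infty^n)=\max\{t\in[0,1]:(t,\dots,t)\in\Gamma(g;\ell_\infty^n)\}$. Then $$\Gamma(g;\ell_\infty^n)=\Big\{s\in[0,1]^g:\ \sum_{i\in I}s_i\le 1\ \text{ for all } I\subseteq[g] \text{ with } |I|\le n\Big\}.$$ Consequently, the maximum that defines the compatibility degree is attained and $\gamma(g;\ell_\infty^n)=1/\min(g,n)$. -/

import Mathlib

/-- A general probabilistic theory `(V, V⁺, 𝟙)` on a finite-dimensional real vector space `V`
(with its unique Hausdorff vector space topology): a proper (closed, salient, generating) convex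
cone `V⁺`, and an order unit `𝟙` of the dual cone `A⁺ ⊆ A = V*`. -/
structure GPT (V : Type*) [AddCommGroup V] [Module ℝ V] [TopologicalSpace V]
    [IsTopologicalAddGroup V] [ContinuousSMul ℝ V] [T2Space V] [FiniteDimensional ℝ V] where
  /-- The cone `V⁺`. -/
  cone : PointedCone ℝ V
  isClosed_cone : IsClosed (cone : Set V)
  salient_cone : ∀ v, v ∈ cone → -v ∈ cone → v = 0
  generating_cone : ∀ v, ∃ x ∈ cone, ∃ y ∈ cone, v = x - y
  /-- The order unit `𝟙`, a functional on `V`. -/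
  unit : Module.Dual ℝ V
  unit_mem : unit ∈ PointedCone.dual (Module.Dual.eval ℝ V) (cone : Set V)
  isOrderUnit_unit : ∀ a : Module.Dual ℝ V, ∃ t : ℝ, 0 < t ∧
    t • unit - a ∈ PointedCone.dual (Module.Dual.eval ℝ V) (cone : Set V) ∧
    a + t • unit ∈ PointedCone.dual (Module.Dual.eval ℝ V) (cone : Set V)

namespace GPT

section General

variable {V : Type*} [AddCommGroup V] [Module ℝ V] [TopologicalSpace V]
  [IsTopologicalAddGroup V] [ContinuousSMul ℝ V] [T2Space V] [FiniteDimensional ℝ V]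

/-- The state space `K = {v ∈ V⁺ : 𝟙(v) = 1}`. -/
def stateSpace (G : GPT V) : Set V := {v | v ∈ G.cone ∧ G.unit v = 1}

/-- The dual cone `A⁺ = (V⁺)*` in `A = V*`. -/
def dualCone (G : GPT V) : PointedCone ℝ (Module.Dual ℝ V) :=
  PointedCone.dual (Module.Dual.eval ℝ V) (G.cone : Set V)

/-- A measurement with outcomes labelled by a finite type: a family of elements of `A⁺` that
sums to `𝟙` (each of them is then an effect, that is, lies between `0` and `𝟙`). -/
def IsMeasurement (G : GPT V) {ι : Type*} [Fintype ι] (f : ι → Module.Dual ℝ V) : Prop :=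
  (∀ i, f i ∈ G.dualCone) ∧ ∑ i, f i = G.unit

/-- Compatibility: the `i`-th member of the collection, with `k i` outcomes, is the `i`-th
marginal of one joint measurement with outcomes in `[k 1] × ⋯ × [k g]`. -/
def Compatible (G : GPT V) {g : ℕ} (k : Fin g → ℕ)
    (f : (i : Fin g) → Fin (k i) → Module.Dual ℝ V) : Prop :=
  ∃ h : ((i : Fin g) → Fin (k i)) → Module.Dual ℝ V, G.IsMeasurement h ∧
    ∀ (i : Fin g) (j : Fin (k i)), f i j = ∑ m with m i = j, h m

/-- The noisy collection `s i • f i + (1 - s i) 𝟙 / k i`. -/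
noncomputable def noisy (G : GPT V) {g : ℕ} (k : Fin g → ℕ) (s : Fin g → ℝ)
    (f : (i : Fin g) → Fin (k i) → Module.Dual ℝ V) :
    (i : Fin g) → Fin (k i) → Module.Dual ℝ V :=
  fun i j => s i • f i j + ((1 - s i) / (k i : ℝ)) • G.unit

/-- The compatibility region `Γ(k; V, V⁺)`: all `s ∈ [0,1]^g` that make every collection of `g`
measurements with `k` outcomes compatible. -/
def compatibilityRegion (G : GPT V) {g : ℕ} (k : Fin g → ℕ) : Set (Fin g → ℝ) :=
  {s | (∀ i, s i ∈ Set.Icc (0 : ℝ) 1) ∧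
    ∀ f : (i : Fin g) → Fin (k i) → Module.Dual ℝ V,
      (∀ i, G.IsMeasurement (f i)) → G.Compatible k (G.noisy k s f)}

/-- The set of `t ∈ [0,1]` with `(t, …, t) ∈ Γ(k; V, V⁺)`. -/
def diagonalRegion (G : GPT V) {g : ℕ} (k : Fin g → ℕ) : Set ℝ :=
  {t | t ∈ Set.Icc (0 : ℝ) 1 ∧ (fun _ => t) ∈ G.compatibilityRegion k}

/-- The compatibility degree `γ(k; V, V⁺)`: the largest element of the diagonal region. -/
noncomputable def compatibilityDegree (G : GPT V) {g : ℕ} (k : Fin g → ℕ) : ℝ :=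
  sSup (G.diagonalRegion k)

end General

section CentrallySymmetric

variable (X : Type*) [NormedAddCommGroup X] [NormedSpace ℝ X] [FiniteDimensional ℝ X]

/-- The centrally symmetric GPT of a finite-dimensional normed space `X`: `V = ℝ ⊕ X`,
`V⁺ = {(x₀, x̄) : ‖x̄‖ ≤ x₀}` and `𝟙(x₀, x̄) = x₀`. -/
noncomputable def centrallySymmetric : GPT (ℝ × X) where
  cone :=
    { carrier := {x | ‖x.2‖ ≤ x.1}
      add_mem' := by
        intro a b ha hb
        exact (norm_add_le _ _).trans (add_le_add ha hb)
      zero_mem' := by simp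
      smul_mem' := by
        intro c x hx
        change ‖(c : ℝ) • x.2‖ ≤ (c : ℝ) * x.1
        rw [norm_smul, Real.norm_of_nonneg c.2]
        exact mul_le_mul_of_nonneg_left hx c.2 }
  isClosed_cone := isClosed_le (continuous_norm.comp continuous_snd) continuous_fst
  salient_cone := by
    intro v hv hv'
    change ‖v.2‖ ≤ v.1 at hv
    change ‖-v.2‖ ≤ -v.1 at hv'
    rw [norm_neg] at hv'
    have h0 := norm_nonneg v.2
    have h1 : v.1 = 0 := by linarith
    have h2 : v.2 = 0 := norm_eq_zero.mp (by linarith)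
    exact Prod.ext h1 h2
  generating_cone := by
    intro v
    refine ⟨(|v.1| + ‖v.2‖, v.2), ?_, (|v.1| + ‖v.2‖ - v.1, 0), ?_, ?_⟩
    · change ‖v.2‖ ≤ |v.1| + ‖v.2‖
      linarith [abs_nonneg v.1]
    · change ‖(0 : X)‖ ≤ |v.1| + ‖v.2‖ - v.1
      rw [norm_zero]
      linarith [le_abs_self v.1, norm_nonneg v.2]
    · exact Prod.ext (by simp) (by simp)
  unit := LinearMap.fst ℝ ℝ X
  unit_mem := by
    intro x hx
    exact (norm_nonneg x.2).trans hx
  isOrderUnit_unit := by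
    intro a
    have key : ∀ x : ℝ × X, ‖x.2‖ ≤ x.1 →
        |a x| ≤ (‖LinearMap.toContinuousLinearMap a‖ + 1) * x.1 := by
      intro x hx
      have h1 := (LinearMap.toContinuousLinearMap a).le_opNorm x
      have hx0 : 0 ≤ x.1 := (norm_nonneg x.2).trans hx
      have h2 : ‖x‖ = x.1 := by
        rw [Prod.norm_def, Real.norm_of_nonneg hx0, max_eq_left hx]
      rw [h2] at h1
      calc |a x| ≤ ‖LinearMap.toContinuousLinearMap a‖ * x.1 := h1
        _ ≤ _ := by nlinarith
    refine ⟨‖LinearMap.toContinuousLinearMap a‖ + 1, by positivity, ?_, ?_⟩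
    · intro x hx
      have h := (abs_le.mp (key x hx)).2
      change 0 ≤ (‖LinearMap.toContinuousLinearMap a‖ + 1) * x.1 - a x
      linarith
    · intro x hx
      have h := (abs_le.mp (key x hx)).1
      change 0 ≤ a x + (‖LinearMap.toContinuousLinearMap a‖ + 1) * x.1
      linarith

/-- The state space of the centrally symmetric GPT of `X` is (a copy of) the unit ball of `X`. -/
theorem stateSpace_centrallySymmetric :
    (centrallySymmetric X).stateSpace = {(1 : ℝ)} ×ˢ Metric.closedBall (0 : X) 1 := by
  ext ⟨r, x⟩
  change ‖x‖ ≤ r ∧ r = 1 ↔ _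
  simp only [Set.mem_prod, Set.mem_singleton_iff, mem_closedBall_zero_iff]
  constructor
  · rintro ⟨h, rfl⟩
    exact ⟨rfl, h⟩
  · rintro ⟨rfl, h⟩
    exact ⟨h, rfl⟩

end CentrallySymmetric

/-- The hypercube GPT: the state space is the unit ball of `ℓ_∞^n`, which is `Fin n → ℝ` with its
supremum norm. -/
noncomputable def hypercube (n : ℕ) : GPT (ℝ × (Fin n → ℝ)) := centrallySymmetric (Fin n → ℝ)

/-- For `n ≥ 1` the cone of the hypercube GPT is `{x : x₀ ≥ max_i |x_i|}`. -/
theorem mem_cone_hypercube {n : ℕ} (hn : 1 ≤ n) (x : ℝ × (Fin n → ℝ)) :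
    x ∈ (hypercube n).cone ↔ ∀ i, |x.2 i| ≤ x.1 := by
  have : Nonempty (Fin n) := ⟨⟨0, hn⟩⟩
  change ‖x.2‖ ≤ x.1 ↔ _
  rw [pi_norm_le_iff_of_nonempty]
  rfl

end GPT

/-! A dichotomic measurement is determined by its observable `f 0 - f 1`, and adding noise
multiplies this observable by `s i`. The jointly measurable tuples of observables form a convex set.
Here the dual cone is the `ℓ¹` cone, so observables fill a cross-polytope with vertices `±𝟙` and
plus or minus the coordinate functionals. Sufficiency therefore reduces to tuples of multiples of
these (`extremal_mem_jointlyMeasurable`). Group the indices by coordinate and let `M k` be the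
largest `s i` in group `k`. Picking one maximizer per group gives at most `n` indices, so the `M k`
sum to at most one. Measure coordinate `k` with probability `M k`, and let each `i` in group `k`
read the result with strength `s i / M k`; the mixture has exactly the required marginals. For
necessity, assign distinct coordinates to the indices in `I`. The `ℓ¹` bound on each element of a
joint measurement, summed over outcomes, gives `∑ i ∈ I, s i ≤ 1`. -/

namespace GPT

/-! ### Joint measurability of observables. -/

section Observables

variable {V : Type*} [AddCommGroup V] [Module ℝ V] [TopologicalSpace V]
  [IsTopologicalAddGroup V] [ContinuousSMul ℝ V] [T2Space V] [FiniteDimensional ℝ V]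

/-- The sign `±1` attached to the outcomes of a dichotomic measurement. -/
def outcomeSign (j : Fin 2) : ℝ := if j = 0 then 1 else -1

/-- The pair of functionals `(𝟙 ± b i) / 2` attached to a tuple `b` of observables. -/
noncomputable def ofObservables (G : GPT V) {g : ℕ} (b : Fin g → Module.Dual ℝ V) :
    (i : Fin g) → Fin ((fun _ : Fin g => 2) i) → Module.Dual ℝ V :=
  fun i j => (1 / 2 : ℝ) • (G.unit + outcomeSign j • b i)

/-- The tuples of observables that are jointly measurable. -/
def jointlyMeasurable (G : GPT V) (g : ℕ) : Set (Fin g → Module.Dual ℝ V) :=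
  {b | G.Compatible (fun _ => 2) (G.ofObservables b)}

theorem mem_dualCone {G : GPT V} {a : Module.Dual ℝ V} :
    a ∈ G.dualCone ↔ ∀ x ∈ G.cone, 0 ≤ a x := Iff.rfl

theorem unit_mem_dualCone (G : GPT V) : G.unit ∈ G.dualCone := G.unit_mem

theorem smul_mem_dualCone {G : GPT V} {a : Module.Dual ℝ V} (ha : a ∈ G.dualCone) {c : ℝ}
    (hc : 0 ≤ c) : c • a ∈ G.dualCone :=
  fun _ hx => mul_nonneg hc (ha hx)

/-- Joint measurements can be mixed, and both the marginals and `ofObservables` are affine. -/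
theorem convex_jointlyMeasurable (G : GPT V) (g : ℕ) : Convex ℝ (G.jointlyMeasurable g) := by
  rintro b ⟨h, ⟨hpos, hsum⟩, hm⟩ b' ⟨h', ⟨hpos', hsum'⟩, hm'⟩ p q hp hq hpq
  refine ⟨fun m => p • h m + q • h' m, ⟨fun m => ?_, ?_⟩, fun i j => ?_⟩
  · exact add_mem (smul_mem_dualCone (hpos m) hp) (smul_mem_dualCone (hpos' m) hq)
  · rw [Finset.sum_add_distrib, ← Finset.smul_sum, ← Finset.smul_sum, hsum, hsum', ← add_smul,
      hpq, one_smul]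
  · rw [Finset.sum_add_distrib, ← Finset.smul_sum, ← Finset.smul_sum, ← hm, ← hm']
    obtain rfl : q = 1 - p := by linarith
    simp only [ofObservables, Pi.add_apply, Pi.smul_apply]
    module

/-- The marginals of a product of probability distributions. -/
theorem sum_filter_prod_eq {ι κ : Type*} [Fintype ι] [DecidableEq ι] [Fintype κ] [DecidableEq κ]
    (p : ι → κ → ℝ) (hp : ∀ i, ∑ j, p i j = 1) (i : ι) (j : κ) :
    ∑ m : ι → κ with m i = j, ∏ l, p l (m l) = p i j := by
  -- The constraint moves into the `i`-th factor, so that the sum over all `m` factorizes.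
  have h1 : ∀ m : ι → κ, (if m i = j then ∏ l, p l (m l) else 0) =
      ∏ l, (if l = i then (if m l = j then p l (m l) else 0) else p l (m l)) := by
    intro m
    split_ifs with h
    · refine Finset.prod_congr rfl fun l _ => ?_
      split_ifs with h2 h3
      · rfl
      · exact absurd (h2 ▸ h) h3
      · rfl
    · exact (Finset.prod_eq_zero (Finset.mem_univ i) (by simp [h])).symm
  rw [Finset.sum_filter, Finset.sum_congr rfl fun m _ => h1 m,
    ← Fintype.prod_sum (fun l x => if l = i then (if x = j then p l x else 0) else p l x),
    Finset.prod_eq_single i]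
  · simp
  · intro l _ hl
    simp [hl, hp]
  · simp

theorem sum_prod_eq_one {ι κ : Type*} [Fintype ι] [DecidableEq ι] [Fintype κ]
    (p : ι → κ → ℝ) (hp : ∀ i, ∑ j, p i j = 1) : ∑ m : ι → κ, ∏ l, p l (m l) = 1 := by
  rw [← Fintype.prod_sum p]
  simp [hp]

/-- Observables that are functions of one sharp observable `e` are jointly measurable. -/
theorem mem_jointlyMeasurable_of_single (G : GPT V) {g : ℕ} {e : Module.Dual ℝ V}
    (he : G.unit + e ∈ G.dualCone) (he' : G.unit - e ∈ G.dualCone) (τ t : Fin g → ℝ)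
    (h : ∀ i, |τ i| + |t i| ≤ 1) :
    (fun i => τ i • G.unit + t i • e) ∈ G.jointlyMeasurable g := by
  -- `p` and `q` are the response distributions, with means `τ i + t i` and `τ i - t i`, when `e`
  -- yields `+1` and `-1`; given that result, the answers are independent.
  set p : Fin g → Fin 2 → ℝ := fun i j => (1 + outcomeSign j * (τ i + t i)) / 2 with hp
  set q : Fin g → Fin 2 → ℝ := fun i j => (1 + outcomeSign j * (τ i - t i)) / 2 with hq
  have hp1 : ∀ i, ∑ j, p i j = 1 := fun i => by
    simp [hp, outcomeSign, Fin.sum_univ_two]; ring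
  have hq1 : ∀ i, ∑ j, q i j = 1 := fun i => by
    simp [hq, outcomeSign, Fin.sum_univ_two]; ring
  have hbound : ∀ i, |τ i + t i| ≤ 1 ∧ |τ i - t i| ≤ 1 := fun i =>
    ⟨(abs_add_le _ _).trans (h i), (abs_sub _ _).trans (h i)⟩
  have hsign : ∀ (j : Fin 2) (x : ℝ), |x| ≤ 1 → 0 ≤ (1 + outcomeSign j * x) / 2 := by
    intro j x hx
    obtain ⟨h1, h2⟩ := abs_le.mp hx
    unfold outcomeSign
    split_ifs <;> linarith
  refine ⟨fun m => (∏ l, p l (m l)) • ((1 / 2 : ℝ) • (G.unit + e)) +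
    (∏ l, q l (m l)) • ((1 / 2 : ℝ) • (G.unit - e)), ⟨fun m => ?_, ?_⟩, fun i j => ?_⟩
  · refine add_mem (smul_mem_dualCone (smul_mem_dualCone he (by norm_num)) ?_)
      (smul_mem_dualCone (smul_mem_dualCone he' (by norm_num)) ?_)
    · exact Finset.prod_nonneg fun l _ => hsign _ _ (hbound l).1
    · exact Finset.prod_nonneg fun l _ => hsign _ _ (hbound l).2
  · rw [Finset.sum_add_distrib, ← Finset.sum_smul, ← Finset.sum_smul, sum_prod_eq_one p hp1,
      sum_prod_eq_one q hq1]
    module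
  · rw [Finset.sum_add_distrib, ← Finset.sum_smul, ← Finset.sum_smul,
      sum_filter_prod_eq p hp1 i j, sum_filter_prod_eq q hq1 i j]
    simp only [ofObservables, hp, hq]
    module

/-- The noisy version of a collection of dichotomic measurements, in terms of observables. -/
theorem noisy_eq_ofObservables (G : GPT V) {g : ℕ} (s : Fin g → ℝ)
    (f : (i : Fin g) → Fin ((fun _ : Fin g => 2) i) → Module.Dual ℝ V)
    (hf : ∀ i, G.IsMeasurement (f i)) :
    G.noisy (fun _ => 2) s f = G.ofObservables (fun i => s i • (f i 0 - f i 1)) := by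
  have hsum : ∀ i, f i 0 + f i 1 = G.unit := fun i => by
    have := (hf i).2
    rwa [Fin.sum_univ_two] at this
  funext i j
  change Fin 2 at j
  simp only [noisy, ofObservables, ← hsum i]
  fin_cases j
  · simp [outcomeSign]
    module
  · simp [outcomeSign]
    module

end Observables

/-! ### The `ℓ¹` dual cone and the cross-polytope of observables. -/

section Hypercube

variable {n : ℕ}

/-- The unit (`none`) and the coordinate functionals (`some k`) of the hypercube GPT. -/
noncomputable def hypercubeFunctional : Option (Fin n) → Module.Dual ℝ (ℝ × (Fin n → ℝ))
  | none => LinearMap.fst ℝ ℝ (Fin n → ℝ)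
  | some k => (LinearMap.proj k).comp (LinearMap.snd ℝ ℝ (Fin n → ℝ))

theorem hypercube_unit_eq : (hypercube n).unit = hypercubeFunctional none := rfl

theorem dual_apply_eq (a : Module.Dual ℝ (ℝ × (Fin n → ℝ))) (x : ℝ × (Fin n → ℝ)) :
    a x = x.1 * a (1, 0) + ∑ k, x.2 k * a (0, Pi.single k 1) := by
  have hx : x = x.1 • ((1 : ℝ), (0 : Fin n → ℝ)) +
      ∑ k, x.2 k • ((0 : ℝ), (Pi.single k 1 : Fin n → ℝ)) := by
    refine Prod.ext ?_ ?_
    · simp [Prod.fst_sum]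
    · funext l
      simp [Prod.snd_sum, Finset.sum_apply, Pi.single_apply]
  conv_lhs => rw [hx]
  simp only [map_add, map_sum, map_smul, smul_eq_mul]

theorem dual_eq_sum_hypercubeFunctional (a : Module.Dual ℝ (ℝ × (Fin n → ℝ))) :
    a = a (1, 0) • hypercubeFunctional none +
      ∑ k, a (0, Pi.single k 1) • hypercubeFunctional (some k) := by
  refine LinearMap.ext fun x => ?_
  rw [dual_apply_eq a x]
  simp [hypercubeFunctional, LinearMap.sum_apply, mul_comm]

theorem hypercubeFunctional_some_apply (k l : Fin n) :
    hypercubeFunctional (some k) (0, Pi.single l 1) = if k = l then (1 : ℝ) else 0 := by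
  simp [hypercubeFunctional, Pi.single_apply]

/-- The dual cone of the hypercube GPT is the `ℓ¹` cone. -/
theorem mem_dualCone_hypercube {a : Module.Dual ℝ (ℝ × (Fin n → ℝ))} :
    a ∈ (hypercube n).dualCone ↔ ∑ k, |a (0, Pi.single k 1)| ≤ a (1, 0) := by
  constructor
  · intro ha
    -- This state minimizes `a` over the cube.
    have hmem : ((1 : ℝ), fun k => -(SignType.sign (a (0, Pi.single k 1)) : ℝ)) ∈
        (hypercube n).cone := by
      change ‖_‖ ≤ (1 : ℝ)
      refine (pi_norm_le_iff_of_nonneg zero_le_one).mpr fun k => ?_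
      rw [norm_neg]
      rcases SignType.sign (a (0, Pi.single k 1)) with _ | _ | _ <;> simp
    have h := mem_dualCone.mp ha _ hmem
    rw [dual_apply_eq] at h
    simp only [neg_mul, sign_mul_self, one_mul, Finset.sum_neg_distrib] at h
    linarith
  · intro h
    refine mem_dualCone.mpr fun x hx => ?_
    change ‖x.2‖ ≤ x.1 at hx
    have h0 : 0 ≤ x.1 := (norm_nonneg _).trans hx
    rw [dual_apply_eq]
    have h1 : -∑ k, x.2 k * a (0, Pi.single k 1) ≤ x.1 * ∑ k, |a (0, Pi.single k 1)| := by
      rw [← Finset.sum_neg_distrib, Finset.mul_sum]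
      refine Finset.sum_le_sum fun k _ => ?_
      refine (neg_le_abs _).trans ?_
      rw [abs_mul]
      exact mul_le_mul_of_nonneg_right ((norm_le_pi_norm x.2 k).trans hx) (abs_nonneg _)
    nlinarith [mul_le_mul_of_nonneg_left h h0]

theorem unit_add_smul_mem_dualCone (k : Fin n) {c : ℝ} (hc : |c| ≤ 1) :
    (hypercube n).unit + c • hypercubeFunctional (some k) ∈ (hypercube n).dualCone := by
  rw [mem_dualCone_hypercube]
  simp only [hypercube_unit_eq, LinearMap.add_apply, LinearMap.smul_apply,
    hypercubeFunctional_some_apply]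
  simpa [hypercubeFunctional, apply_ite] using hc

/-- The observable of a dichotomic measurement lies in the convex hull of the multiples of `𝟙` and
of the coordinate functionals. -/
theorem observable_mem_convexHull {f : Fin 2 → Module.Dual ℝ (ℝ × (Fin n → ℝ))}
    (hf : (hypercube n).IsMeasurement f) :
    f 0 - f 1 ∈ convexHull ℝ
      {b | ∃ (c : ℝ) (o : Option (Fin n)), |c| ≤ 1 ∧ b = c • hypercubeFunctional o} := by
  set E : Set (Module.Dual ℝ (ℝ × (Fin n → ℝ))) :=
    {b | ∃ (c : ℝ) (o : Option (Fin n)), |c| ≤ 1 ∧ b = c • hypercubeFunctional o}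
  have hsum : f 0 + f 1 = (hypercube n).unit := by
    have := hf.2
    rwa [Fin.sum_univ_two] at this
  have h0 := mem_dualCone_hypercube.mp (hf.1 0)
  have h1 := mem_dualCone_hypercube.mp (hf.1 1)
  have hu : f 0 (1, 0) + f 1 (1, 0) = 1 := by
    rw [← LinearMap.add_apply, hsum]
    rfl
  have hk : ∀ k, f 1 (0, Pi.single k 1) = -f 0 (0, Pi.single k 1) := fun k => by
    have : f 0 (0, Pi.single k 1) + f 1 (0, Pi.single k 1) = 0 := by
      rw [← LinearMap.add_apply, hsum]
      rfl
    linarith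
  simp only [hk, abs_neg] at h1
  set c : Option (Fin n) → ℝ := fun o => o.elim ((f 0 - f 1) (1, 0))
    fun k => (f 0 - f 1) (0, Pi.single k 1) with hc
  -- Both effects have the same coordinate `ℓ¹` norm `S`, and their unit coefficients are at least
  -- `S` with sum one. The coefficients thus differ by at most `1 - 2 * S`, while the coordinates of
  -- the observable contribute `2 * S`.
  have hcsum : ∑ o, |c o| ≤ 1 := by
    have h2 : ∀ k, |c (some k)| = 2 * |f 0 (0, Pi.single k 1)| := fun k => by
      simp only [hc, Option.elim_some, LinearMap.sub_apply, hk, sub_neg_eq_add]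
      rw [← two_mul, abs_mul, abs_two]
    rw [Fintype.sum_option, Finset.sum_congr rfl fun k _ => h2 k, ← Finset.mul_sum]
    have h3 : |c none| ≤ 1 - 2 * ∑ k, |f 0 (0, Pi.single k 1)| := by
      simp only [hc, Option.elim_none, LinearMap.sub_apply]
      exact abs_le.mpr ⟨by linarith, by linarith⟩
    linarith
  have hrep : f 0 - f 1 = ∑ o, |c o| • ((SignType.sign (c o) : ℝ) • hypercubeFunctional o) +
      (1 - ∑ o, |c o|) • (0 : Module.Dual ℝ (ℝ × (Fin n → ℝ))) := by
    simp only [smul_smul, abs_mul_sign, smul_zero, add_zero]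
    rw [Fintype.sum_option]
    exact dual_eq_sum_hypercubeFunctional _
  have hmem : ∀ o, (SignType.sign (c o) : ℝ) • hypercubeFunctional o ∈ convexHull ℝ E := by
    refine fun o => subset_convexHull ℝ E ⟨_, o, ?_, rfl⟩
    rcases SignType.sign (c o) with _ | _ | _ <;> simp
  have hzero : (0 : Module.Dual ℝ (ℝ × (Fin n → ℝ))) ∈ convexHull ℝ E :=
    subset_convexHull ℝ E ⟨0, none, by simp, by simp⟩
  -- The outer `none` puts the slack weight `1 - ∑ o, |c o|` on the zero observable.
  have key := (convex_convexHull ℝ E).sum_mem (t := (Finset.univ : Finset (Option (Option (Fin n)))))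
    (w := fun o => o.elim (1 - ∑ o, |c o|) fun o => |c o|)
    (z := fun o => o.elim 0 fun o => (SignType.sign (c o) : ℝ) • hypercubeFunctional o) ?_ ?_ ?_
  · rw [Fintype.sum_option] at key
    rw [hrep, add_comm]
    exact key
  · rintro (_ | o) -
    · exact sub_nonneg.mpr hcsum
    · exact abs_nonneg _
  · rw [Fintype.sum_option]
    simp
  · rintro (_ | o) -
    · exact hzero
    · exact hmem o

/-! ### Sufficiency of the partial-sum inequalities. -/

/-- The numbers `max {s i : o i = some k}` sum to at most one. -/
theorem exists_group_maxima {g : ℕ} {s : Fin g → ℝ} (hs : ∀ i, 0 ≤ s i)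
    (hI : ∀ I : Finset (Fin g), I.card ≤ n → ∑ i ∈ I, s i ≤ 1) (o : Fin g → Option (Fin n)) :
    ∃ M : Fin n → ℝ, (∀ k, 0 ≤ M k) ∧ (∀ i k, o i = some k → s i ≤ M k) ∧ ∑ k, M k ≤ 1 := by
  have hex : ∀ k, ∃ r : ℝ, 0 ≤ r ∧ (∀ i, o i = some k → s i ≤ r) ∧
      -- An empty group gets the value zero, so only nonzero maxima need to be attained.
      (r ≠ 0 → ∃ i, o i = some k ∧ s i = r) := by
    intro k
    rcases (Finset.univ.filter fun i => o i = some k).eq_empty_or_nonempty with h | h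
    · refine ⟨0, le_rfl, fun i hi => ?_, fun h => absurd rfl h⟩
      exact absurd (Finset.mem_filter.mpr ⟨Finset.mem_univ i, hi⟩) (h ▸ Finset.notMem_empty i)
    · obtain ⟨i, hi, hmax⟩ := Finset.exists_max_image _ s h
      exact ⟨s i, hs i, fun l hl => hmax l (Finset.mem_filter.mpr ⟨Finset.mem_univ l, hl⟩),
        fun _ => ⟨i, (Finset.mem_filter.mp hi).2, rfl⟩⟩
  choose M hM0 hM1 hM2 using hex
  refine ⟨M, hM0, fun i k => hM1 k i, ?_⟩
  by_cases hg : Nonempty (Fin g)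
  · have hex' : ∀ k, ∃ i, M k ≠ 0 → o i = some k ∧ s i = M k := fun k => by
      by_cases h : M k = 0
      · exact ⟨hg.some, fun h' => absurd h h'⟩
      · exact (hM2 k h).imp fun i hi _ => hi
    choose r hr using hex'
    rw [← Finset.sum_filter_ne_zero]
    -- The groups are disjoint, so their maximizers are distinct.
    have hinj : Set.InjOn r (Finset.univ.filter fun k => M k ≠ 0 : Finset (Fin n)) := by
      intro k hk l hl hkl
      have h1 := (hr k (by simpa using hk)).1
      have h2 := (hr l (by simpa using hl)).1
      rw [hkl, h2] at h1
      exact (Option.some.inj h1).symm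
    have hcard := hI ((Finset.univ.filter fun k => M k ≠ 0).image r)
      (Finset.card_image_le.trans ((Finset.card_le_univ _).trans_eq (Fintype.card_fin n)))
    rw [Finset.sum_image hinj] at hcard
    refine le_trans (le_of_eq (Finset.sum_congr rfl fun k hk => ?_)) hcard
    exact (hr k (Finset.mem_filter.mp hk).2).2.symm
  · refine (Finset.sum_eq_zero fun k _ => ?_).le.trans zero_le_one
    by_contra h
    exact hg ⟨(hM2 k h).choose⟩

/-- Joint measurability of shrunk extremal observables. -/
theorem extremal_mem_jointlyMeasurable {g : ℕ} {s : Fin g → ℝ} (hs : ∀ i, s i ∈ Set.Icc (0 : ℝ) 1)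
    (hI : ∀ I : Finset (Fin g), I.card ≤ n → ∑ i ∈ I, s i ≤ 1) (c : Fin g → ℝ)
    (hc : ∀ i, |c i| ≤ 1) (o : Fin g → Option (Fin n)) :
    (fun i => s i • c i • hypercubeFunctional (o i)) ∈ (hypercube n).jointlyMeasurable g := by
  obtain ⟨M, hM0, hM1, hM2⟩ := exists_group_maxima (fun i => (hs i).1) hI o
  have hsc : ∀ i, |s i * c i| ≤ 1 := fun i => by
    rw [abs_mul, abs_of_nonneg (hs i).1]
    exact mul_le_one₀ (hs i).2 (abs_nonneg _) (hc i)
  set τ : Fin g → ℝ := fun i => if o i = none then s i * c i else 0 with hτ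
  set t : Fin n → Fin g → ℝ := fun k i => if o i = some k then s i / M k * c i else 0 with ht
  -- In branch `k` only coordinate `k` is measured: indices of other groups answer by a fair coin,
  -- and multiples of the unit are reproduced in every branch.
  have hmem : ∀ k, (fun i => τ i • (hypercube n).unit + t k i • hypercubeFunctional (some k)) ∈
      (hypercube n).jointlyMeasurable g := by
    intro k
    refine mem_jointlyMeasurable_of_single _ ?_ ?_ _ _ fun i => ?_
    · simpa using unit_add_smul_mem_dualCone k (c := 1) (by simp)
    · have h := unit_add_smul_mem_dualCone k (c := -1) (by simp)
      convert h using 1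
      module
    · rcases h : o i with _ | l
      · simpa [hτ, ht, h] using hsc i
      · by_cases hl : l = k
        · subst hl
          simp only [hτ, ht, h, if_true, reduceCtorEq, if_false, abs_zero, zero_add, abs_mul]
          refine mul_le_one₀ ?_ (abs_nonneg _) (hc i)
          rw [abs_of_nonneg (div_nonneg (hs i).1 (hM0 l))]
          exact div_le_one_of_le₀ (hM1 i l h) (hM0 l)
        · simp [hτ, ht, h, hl]
  have hmem0 : (fun i => τ i • (hypercube n).unit) ∈ (hypercube n).jointlyMeasurable g := by
    have := mem_jointlyMeasurable_of_single (hypercube n) (e := 0)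
      (by simpa using (hypercube n).unit_mem_dualCone) (by simpa using (hypercube n).unit_mem_dualCone) τ 0
      fun i => by
        by_cases h : o i = none
        · simpa [hτ, h] using hsc i
        · simp [hτ, h]
    simpa using this
  -- The leftover weight `1 - ∑ k, M k` goes to a branch that measures no coordinate.
  have key := (convex_jointlyMeasurable (hypercube n) g).sum_mem
    (t := (Finset.univ : Finset (Option (Fin n))))
    (w := fun k => k.elim (1 - ∑ k, M k) M)
    (z := fun k => k.elim (fun i => τ i • (hypercube n).unit)
      fun k i => τ i • (hypercube n).unit + t k i • hypercubeFunctional (some k)) ?_ ?_ ?_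
  · convert key using 1
    rw [Fintype.sum_option]
    funext i
    simp only [Option.elim_none, Option.elim_some, Pi.add_apply, Pi.smul_apply, Finset.sum_apply,
      smul_add, Finset.sum_add_distrib, ← Finset.sum_smul]
    rw [← add_assoc, ← add_smul, sub_add_cancel, one_smul]
    rcases h : o i with _ | l
    · simp [hτ, ht, h, hypercube_unit_eq, smul_smul]
    -- If `M l = 0`, then `s i = 0` too, so the convention for division by zero is harmless.
    · have hl : M l * (s i / M l) = s i := by
        rcases eq_or_ne (M l) 0 with h0 | h0
        · rw [h0, zero_mul]
          exact le_antisymm (hs i).1 (h0 ▸ hM1 i l h)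
        · field_simp
      rw [Finset.sum_eq_single l]
      · simp only [hτ, ht, h, if_true, reduceCtorEq, if_false, zero_smul, zero_add, smul_smul]
        rw [← mul_assoc, hl]
      · intro k _ hk
        simp [ht, h, hk.symm]
      · simp
  · rintro (_ | k) -
    · exact sub_nonneg.mpr hM2
    · exact hM0 k
  · rw [Fintype.sum_option]
    simp
  · rintro (_ | k) -
    · exact hmem0
    · exact hmem k

/-- The convex hull of a product is the product of the hulls (`convexHull_pi`), and scaling by `s`
is linear; hence the extremal tuples suffice. -/
theorem mem_compatibilityRegion_of_sum_le {g : ℕ} {s : Fin g → ℝ}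
    (hs : ∀ i, s i ∈ Set.Icc (0 : ℝ) 1)
    (hI : ∀ I : Finset (Fin g), I.card ≤ n → ∑ i ∈ I, s i ≤ 1) :
    s ∈ (hypercube n).compatibilityRegion (fun _ : Fin g => 2) := by
  refine ⟨hs, fun f hf => ?_⟩
  rw [noisy_eq_ofObservables _ s f hf]
  set E : Set (Module.Dual ℝ (ℝ × (Fin n → ℝ))) :=
    {b | ∃ (c : ℝ) (o : Option (Fin n)), |c| ≤ 1 ∧ b = c • hypercubeFunctional o}
  let L : (Fin g → Module.Dual ℝ (ℝ × (Fin n → ℝ))) →ₗ[ℝ]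
      (Fin g → Module.Dual ℝ (ℝ × (Fin n → ℝ))) :=
    LinearMap.pi fun i => s i • LinearMap.proj i
  have hsub : Set.univ.pi (fun _ : Fin g => E) ⊆ L ⁻¹' (hypercube n).jointlyMeasurable g := by
    intro b hb
    choose c o hc hb using fun i => hb i (Set.mem_univ i)
    have hL : L b = fun i => s i • c i • hypercubeFunctional (o i) := by
      funext i
      simp [L, hb i]
    rw [Set.mem_preimage, hL]
    exact extremal_mem_jointlyMeasurable hs hI c hc o
  have hhull := convexHull_min hsub
    ((convex_jointlyMeasurable (hypercube n) g).linear_preimage L)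
  rw [convexHull_pi] at hhull
  exact hhull fun i _ => observable_mem_convexHull (hf i)

/-! ### Necessity, and the compatibility degree. -/

theorem sum_le_of_mem_compatibilityRegion {g : ℕ} {s : Fin g → ℝ}
    (hs : s ∈ (hypercube n).compatibilityRegion (fun _ : Fin g => 2))
    (I : Finset (Fin g)) (hI : I.card ≤ n) : ∑ i ∈ I, s i ≤ 1 := by
  classical
  obtain ⟨κ⟩ : Nonempty (I ↪ Fin n) :=
    Function.Embedding.nonempty_of_card_le (by simpa using hI)
  set b : Fin g → Module.Dual ℝ (ℝ × (Fin n → ℝ)) := fun i =>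
    if h : i ∈ I then hypercubeFunctional (some (κ ⟨i, h⟩)) else 0 with hb
  have hbound : ∀ i (c : ℝ), |c| ≤ 1 →
      (hypercube n).unit + c • b i ∈ (hypercube n).dualCone := by
    intro i c hc
    by_cases h : i ∈ I
    · simpa [hb, h] using unit_add_smul_mem_dualCone (κ ⟨i, h⟩) hc
    · simpa [hb, h] using (hypercube n).unit_mem_dualCone
  have hf : ∀ i, (hypercube n).IsMeasurement ((hypercube n).ofObservables b i) := by
    intro i
    refine ⟨fun j => smul_mem_dualCone (hbound i _ ?_) (by norm_num), ?_⟩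
    · unfold outcomeSign
      split_ifs <;> simp
    · rw [Fin.sum_univ_two]
      simp only [ofObservables, outcomeSign, if_true, one_ne_zero, if_false]
      module
  obtain ⟨h, ⟨hpos, hsum⟩, hm⟩ := hs.2 _ hf
  -- The difference of the two `i`-th marginals is `s i • b i`; its `κ i` coefficient is a signed
  -- sum of those of the `h m`.
  have hle : ∀ i : I, s i ≤ ∑ m, |h m (0, Pi.single (κ i) 1)| := by
    intro i
    have h0 := hm i 0
    have h1 := hm i 1
    rw [noisy_eq_ofObservables _ s _ hf] at h0 h1
    have hbi : b i = hypercubeFunctional (some (κ i)) := by simp [hb]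
    have hd : s i • b i = ∑ m with m i = 0, h m - ∑ m with m i = 1, h m := by
      rw [← h0, ← h1]
      simp only [ofObservables, outcomeSign, if_true, one_ne_zero, if_false]
      module
    have hd' := congrArg (fun a => a ((0 : ℝ), (Pi.single (κ i) 1 : Fin n → ℝ))) hd
    simp only [hbi, LinearMap.smul_apply, hypercubeFunctional_some_apply, if_true,
      LinearMap.sub_apply, LinearMap.sum_apply, smul_eq_mul, mul_one] at hd'
    rw [hd', Finset.sum_filter, Finset.sum_filter, ← Finset.sum_sub_distrib]
    refine Finset.sum_le_sum fun m _ => ?_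
    rcases eq_or_ne (m i) 0 with h2 | h2
    · simpa [h2] using le_abs_self _
    · rw [if_neg h2]
      split_ifs
      · simpa using neg_le_abs _
      · simp
  calc ∑ i ∈ I, s i = ∑ i : I, s i := (Finset.sum_coe_sort I s).symm
    _ ≤ ∑ i : I, ∑ m, |h m (0, Pi.single (κ i) 1)| := Finset.sum_le_sum fun i _ => hle i
    _ = ∑ m, ∑ i : I, |h m (0, Pi.single (κ i) 1)| := Finset.sum_comm
    _ ≤ ∑ m, h m (1, 0) := Finset.sum_le_sum fun m _ => by
        refine le_trans ?_ (mem_dualCone_hypercube.mp (hpos m))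
        -- Injectivity of `κ` makes this part of the `ℓ¹` norm of `h m`, with no coordinate counted
        -- twice.
        rw [← Finset.sum_map Finset.univ κ fun k => |h m (0, Pi.single k 1)|]
        exact Finset.sum_le_sum_of_subset_of_nonneg (Finset.subset_univ _)
          fun _ _ _ => abs_nonneg _
    _ = 1 := by
        rw [← LinearMap.sum_apply, hsum]
        rfl

theorem compatibilityRegion_hypercube (g n : ℕ) :
    (hypercube n).compatibilityRegion (fun _ : Fin g => 2) =
      {s : Fin g → ℝ | (∀ i, s i ∈ Set.Icc (0 : ℝ) 1) ∧
        ∀ I : Finset (Fin g), I.card ≤ n → ∑ i ∈ I, s i ≤ 1} :=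
  Set.ext fun _ => ⟨fun hs => ⟨hs.1, sum_le_of_mem_compatibilityRegion hs⟩,
    fun hs => mem_compatibilityRegion_of_sum_le hs.1 hs.2⟩

theorem isGreatest_diagonalRegion_hypercube {g n : ℕ} (hg : 1 ≤ g) (hn : 1 ≤ n) :
    IsGreatest ((hypercube n).diagonalRegion (fun _ : Fin g => 2))
      (1 / ((min g n : ℕ) : ℝ)) := by
  have hmin : (1 : ℝ) ≤ ((min g n : ℕ) : ℝ) := by exact_mod_cast le_min hg hn
  have hpos : (0 : ℝ) < ((min g n : ℕ) : ℝ) := zero_lt_one.trans_le hmin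
  have h01 : 1 / ((min g n : ℕ) : ℝ) ∈ Set.Icc (0 : ℝ) 1 :=
    ⟨by positivity, (div_le_one hpos).mpr hmin⟩
  constructor
  · refine ⟨h01, ?_⟩
    rw [compatibilityRegion_hypercube]
    refine ⟨fun _ => h01, fun I hI => ?_⟩
    have hcard : (I.card : ℝ) ≤ ((min g n : ℕ) : ℝ) := by
      exact_mod_cast le_min (I.card_le_univ.trans_eq (Fintype.card_fin g)) hI
    rw [Finset.sum_const, nsmul_eq_mul, mul_one_div]
    exact (div_le_one hpos).mpr hcard
  · rintro t ⟨-, ht⟩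
    rw [compatibilityRegion_hypercube] at ht
    -- On the diagonal, the largest admissible `I` gives the tightest constraint.
    obtain ⟨I, -, hI⟩ := Finset.exists_subset_card_eq
      (s := (Finset.univ : Finset (Fin g))) (n := min g n) (by simp)
    have h := ht.2 I (hI ▸ min_le_right g n)
    rw [Finset.sum_const, nsmul_eq_mul, hI] at h
    rw [le_div_iff₀ hpos, mul_comm]
    exact h

end Hypercube

end GPT

theorem mainTheorem8 (g n : ℕ) (hg : 1 ≤ g) (hn : 1 ≤ n) :
    (GPT.hypercube n).compatibilityRegion (fun _ : Fin g => 2) =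
        {s : Fin g → ℝ | (∀ i, s i ∈ Set.Icc (0 : ℝ) 1) ∧
          ∀ I : Finset (Fin g), I.card ≤ n → ∑ i ∈ I, s i ≤ 1} ∧
      IsGreatest ((GPT.hypercube n).diagonalRegion (fun _ : Fin g => 2))
        (1 / ((min g n : ℕ) : ℝ)) ∧
      (GPT.hypercube n).compatibilityDegree (fun _ : Fin g => 2) = 1 / ((min g n : ℕ) : ℝ) := by
  exact ⟨GPT.compatibilityRegion_hypercube g n, GPT.isGreatest_diagonalRegion_hypercube hg hn,
    (GPT.isGreatest_diagonalRegion_hypercube hg hn).csSup_eq⟩
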